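/- Let $M$ be a Markov chain on a finite state set $Q$, given by an initial distribution $\pi$ on $Q$ and transition probabilities $p(q,\cdot)$, each a probability distribution on $Q$. Assume that $M$ is connected: every state can be reached from every state along transitions of positive probability. Let $s:\mathbb{N}\to\mathbb{N}$ be an arbitrary function (the offset function). Let $(X_i)_{i\ge 1}$ be a sequence of $Q$-valued random variables on a probability space that is $\mathrm{Markov}(M)$: $X_1$ has distribution $\pi$, and conditionally on any history $X_1=x_1,\dots,X_n=x_n$ of positive probability, $X_{n+1}$ has distribution $p(x_n,\cdot)$. For $q\in Q$ and $n,k\in\mathbb{N}$ let $$V_q^n(k)=\sum_{i=1}^{k}\mathbf 1_{\{X_{s(n)+i}=q\}}$$ be the number of visits to $q$ within the first $k$ steps of the $n$-th suffix $X_{s(n)+1}X_{s(n)+2}\cdots$. Let $f_q=1/m_q$, where $m_q=\mathbb{E}_q\big[\inf\{k\ge 1: Y_k=q\}\big]$ is the expected return time to $q$ of a chain $(Y_k)_{k\ge 0}$ with transition probabilities $p$ and $Y_0=q$. Then for every state $q$, $$\frac{V_q^n(n)}{n}\xrightarrow{\text{a.s.}} f_q\qquad\text{as } n\to\infty .$$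 -/

import Mathlib

open MeasureTheory ProbabilityTheory Filter Topology
open scoped ENNReal

/-- A (time-homogeneous) Markov chain on the state space `Q`: an initial distribution and, for
every state, a probability distribution on the successor states. -/
structure MarkovChain (Q : Type*) where
  /-- The initial distribution. -/
  initial : PMF Q
  /-- `trans q q'` is the probability of moving from `q` to `q'` in one step. -/
  trans : Q → PMF Q

namespace MarkovChain

/-- The chain is connected: every state can be reached from every state along transitions of
positive probability (the transition graph is strongly connected). -/
def Connected {Q : Type*} (M : MarkovChain Q) : Prop :=
  ∀ q q' : Q, Relation.ReflTransGen (fun a b => M.trans a b ≠ 0) q q'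

/-- The sequence `X 1, X 2, …` of `Q`-valued random variables on `(Ω, μ)` is `Markov(M)`: `X 1` is
distributed according to the initial distribution of `M`, and conditionally on any history
`X 1 = x 1, …, X n = x n` of positive probability, `X (n + 1)` is distributed according to the
transition distribution of `M` at `x n`. The sequence starts at index `1`; `X 0` plays no role. -/
structure IsMarkov {Q : Type*} [MeasurableSpace Q] (M : MarkovChain Q)
    {Ω : Type*} [MeasurableSpace Ω] (X : ℕ → Ω → Q) (μ : Measure Ω) : Prop where
  measurable : ∀ n, 1 ≤ n → Measurable (X n)
  initial : ∀ q : Q, μ {ω | X 1 ω = q} = M.initial q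
  step : ∀ n, 1 ≤ n → ∀ (x : ℕ → Q) (q : Q),
    μ {ω | ∀ i, 1 ≤ i → i ≤ n → X i ω = x i} ≠ 0 →
      μ[|{ω | ∀ i, 1 ≤ i → i ≤ n → X i ω = x i}] {ω | X (n + 1) ω = q} = M.trans (x n) q

section PathSpace

variable {Q : Type*} [Countable Q] [MeasurableSpace Q] [DiscreteMeasurableSpace Q]

/-- The transition probabilities of `M` as a kernel from states to states. -/
noncomputable def kernel (M : MarkovChain Q) : Kernel Q Q :=
  Kernel.ofFunOfCountable fun q => (M.trans q).toMeasure

instance (M : MarkovChain Q) : IsMarkovKernel M.kernel :=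
  ⟨fun q => PMF.toMeasure.isProbabilityMeasure (M.trans q)⟩

/-- The transition probabilities of `M` at time `n`, as a kernel from histories `x 0, …, x n` to
states; it depends on the last state `x n` only. -/
noncomputable def historyKernel (M : MarkovChain Q) (n : ℕ) :
    Kernel ((i : Finset.Iic n) → (fun _ : ℕ => Q) i) Q :=
  M.kernel.comap (fun x => x ⟨n, Finset.mem_Iic.2 le_rfl⟩) (measurable_pi_apply _)

instance (M : MarkovChain Q) (n : ℕ) : IsMarkovKernel (M.historyKernel n) := by
  unfold historyKernel; infer_instance

/-- The law, on the space of infinite paths `x 0, x 1, …`, of the chain with the transition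
probabilities of `M` started in the state `q` at time `0`. -/
noncomputable def pathMeasure (M : MarkovChain Q) (q : Q) : Measure (ℕ → Q) :=
  Kernel.trajMeasure (X := fun _ : ℕ => Q) (PMF.pure q).toMeasure M.historyKernel

end PathSpace

/-- The time of the first visit to `q` at a time `n ≥ 1` along the path `x`, infinite if there is
no such visit. For a path that starts in `q` at time `0` this is the return time to `q`. -/
noncomputable def returnTime {Q : Type*} (q : Q) (x : ℕ → Q) : ℕ∞ :=
  ⨅ (n : ℕ) (_ : 1 ≤ n ∧ x n = q), (n : ℕ∞)

/-- The expected return time to `q` of the chain started in `q`. -/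
noncomputable def expectedReturnTime {Q : Type*} [Countable Q] [MeasurableSpace Q]
    [DiscreteMeasurableSpace Q] (M : MarkovChain Q) (q : Q) : ℝ≥0∞ :=
  ∫⁻ x, (returnTime q x : ℝ≥0∞) ∂(M.pathMeasure q)

/-- The frequency `f_q` of the state `q`: the inverse of the expected return time to `q`. (The
expected return time is at least `1`, and the frequency is `0` if it is infinite.) -/
noncomputable def frequency {Q : Type*} [Countable Q] [MeasurableSpace Q]
    [DiscreteMeasurableSpace Q] (M : MarkovChain Q) (q : Q) : ℝ :=
  (M.expectedReturnTime q)⁻¹.toReal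

end MarkovChain

open Classical in
/-- `visits s X q n k ω` is the number of visits of the sequence `X 1, X 2, …` to the state `q`
within the first `k` steps of its `n`-th suffix `X (s n + 1), X (s n + 2), …`. -/
noncomputable def visits {Q Ω : Type*} (s : ℕ → ℕ) (X : ℕ → Ω → Q) (q : Q) (n k : ℕ) (ω : Ω) : ℕ :=
  ∑ i ∈ Finset.Icc 1 k, if X (s n + i) ω = q then 1 else 0

/-!
Let `v x` be the expected time of the first visit to `q` at a time `n ≥ 0` of the chain started in
`x`. Conditioning on the first step shows that `v` solves the Poisson equation of the indicator
function of `q`: along every path `y`, `m_q` times the number of visits to `q` among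
`y 0, …, y (k - 1)` equals `k` plus the boundary term `v (y k) - v (y 0)` minus a sum of `k`
martingale differences of `v`. As `v` is bounded, the boundary term is negligible and, by the
Azuma–Hoeffding inequality, the probability that the martingale sum exceeds `k * ε` decays
exponentially in `k`, at a rate that depends neither on the law of `y 0` nor, therefore, on the
offset of the suffix. So the Borel–Cantelli lemma, which needs no independence, applies along
suffixes that bear no relation to each other.
-/

open scoped NNReal

section SubGaussian

variable {Ω : Type*} [MeasurableSpace Ω] {μ : Measure Ω}

lemma hasSubgaussianMGF_mono {Z : Ω → ℝ} {c d : ℝ≥0} (hZ : HasSubgaussianMGF Z c μ)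
    (hcd : c ≤ d) : HasSubgaussianMGF Z d μ where
  integrable_exp_mul := hZ.integrable_exp_mul
  mgf_le t := (hZ.mgf_le t).trans (by gcongr)

lemma hasSubgaussianMGF_map_iff {Ω' : Type*} [MeasurableSpace Ω'] {Y : Ω → Ω'} {Z : Ω' → ℝ}
    {c : ℝ≥0} (hY : Measurable Y) (hZ : Measurable Z) :
    HasSubgaussianMGF Z c (μ.map Y) ↔ HasSubgaussianMGF (Z ∘ Y) c μ := by
  rw [← HasSubgaussianMGF.id_map_iff hZ.aemeasurable, Measure.map_map hZ hY,
    HasSubgaussianMGF.id_map_iff (hZ.comp hY).aemeasurable]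

lemma kernel_hasSubgaussianMGF_of_forall {α β : Type*} [MeasurableSpace α] [MeasurableSpace β]
    {κ : Kernel α β} {ν : Measure α} [IsFiniteMeasure ν] {Z : β → ℝ} {c : ℝ≥0}
    (hZm : Measurable Z) (hZ : ∀ a, HasSubgaussianMGF Z c (κ a)) :
    Kernel.HasSubgaussianMGF Z c κ ν where
  integrable_exp_mul t := by
    have hm : Measurable fun b => Real.exp (t * Z b) := by fun_prop
    rw [Measure.integrable_comp_iff hm.aestronglyMeasurable]
    refine ⟨ae_of_all _ fun a => (hZ a).integrable_exp_mul t,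
      Integrable.of_bound (C := Real.exp (c * t ^ 2 / 2))
        hm.norm.stronglyMeasurable.integral_kernel.aestronglyMeasurable (ae_of_all _ fun a => ?_)⟩
    rw [Real.norm_of_nonneg (integral_nonneg fun _ => norm_nonneg _)]
    simpa only [mgf, Real.norm_eq_abs, Real.abs_exp] using (hZ a).mgf_le t
  mgf_le := ae_of_all _ fun a => (hZ a).mgf_le

lemma hasSubgaussianMGF_add_compProd {α β : Type*} [MeasurableSpace α] [MeasurableSpace β]
    {ν : Measure α} [IsFiniteMeasure ν] {κ : Kernel α β} [IsMarkovKernel κ]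
    {Y : α → ℝ} {Z : β → ℝ} {c d : ℝ≥0} (hY : HasSubgaussianMGF Y c ν) (hZm : Measurable Z)
    (hZ : ∀ a, HasSubgaussianMGF Z d (κ a)) :
    HasSubgaussianMGF (fun p : α × β => Y p.1 + Z p.2) (c + d) (ν ⊗ₘ κ) := by
  rw [HasSubgaussianMGF_iff_kernel] at hY ⊢
  exact hY.add_comp (kernel_hasSubgaussianMGF_of_forall hZm hZ)

lemma hasSubgaussianMGF_comp {α β : Type*} [MeasurableSpace α] [MeasurableSpace β]
    {ν : Measure α} [IsProbabilityMeasure ν] {κ : Kernel α β} [IsMarkovKernel κ]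
    {Z : β → ℝ} {c : ℝ≥0} (hZm : Measurable Z) (hZ : ∀ a, HasSubgaussianMGF Z c (κ a)) :
    HasSubgaussianMGF Z c (κ ∘ₘ ν) := by
  have hsum := hasSubgaussianMGF_add_compProd (.zero (μ := ν)) hZm hZ
  rw [← Measure.snd_compProd, Measure.snd, hasSubgaussianMGF_map_iff measurable_snd hZm]
  simpa [Function.comp_def] using hsum

lemma ae_eventually_lt_mul_of_hasSubgaussianMGF [IsFiniteMeasure μ] {Z : ℕ → Ω → ℝ} {c : ℝ≥0}
    (hZ : ∀ n : ℕ, HasSubgaussianMGF (Z n) (n * c) μ) {ε : ℝ} (hε : 0 < ε) :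
    ∀ᵐ ω ∂μ, ∀ᶠ n : ℕ in atTop, Z n ω < n * ε := by
  -- The variance proxy is enlarged to `c + 1`, as the Chernoff exponent divides by it.
  have chernoff (n : ℕ) :
      μ.real {ω | n * ε ≤ Z n ω} ≤ Real.exp (n * (-ε ^ 2 / (2 * (c + 1)))) := by
    have hZ' : HasSubgaussianMGF (Z n) (n * (c + 1)) μ :=
      hasSubgaussianMGF_mono (hZ n) (by gcongr; exact le_self_add)
    refine (hZ'.measure_ge_le (by positivity)).trans_eq (congrArg Real.exp ?_)
    rcases eq_or_ne n 0 with rfl | hn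
    · simp
    · push_cast
      field_simp
  have summable_chernoff : Summable fun n : ℕ => Real.exp (n * (-ε ^ 2 / (2 * (c + 1)))) :=
    Real.summable_exp_nat_mul_iff.2 (div_neg_of_neg_of_pos (neg_neg_of_pos (pow_pos hε 2))
      (by positivity))
  have summable_tail : Summable fun n : ℕ => μ.real {ω | n * ε ≤ Z n ω} :=
    summable_chernoff.of_nonneg_of_le (fun _ => measureReal_nonneg) chernoff
  have borel_cantelli := ae_eventually_notMem (μ := μ) (s := fun n : ℕ => {ω | n * ε ≤ Z n ω})
    (by simpa [ofReal_measureReal] using summable_tail.tsum_ofReal_ne_top)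
  simpa using borel_cantelli

lemma ae_tendsto_div_zero_of_hasSubgaussianMGF [IsFiniteMeasure μ] {Z : ℕ → Ω → ℝ} {c : ℝ≥0}
    (hZ : ∀ n : ℕ, HasSubgaussianMGF (Z n) (n * c) μ) :
    ∀ᵐ ω ∂μ, Tendsto (fun n : ℕ => Z n ω / n) atTop (𝓝 0) := by
  have upper (m : ℕ) := ae_eventually_lt_mul_of_hasSubgaussianMGF hZ
    (Nat.one_div_pos_of_nat (n := m))
  have lower (m : ℕ) := ae_eventually_lt_mul_of_hasSubgaussianMGF (fun n => (hZ n).neg)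
    (Nat.one_div_pos_of_nat (n := m))
  filter_upwards [ae_all_iff.2 upper, ae_all_iff.2 lower] with ω hupper hlower
  refine Metric.tendsto_nhds.2 fun ε hε => ?_
  obtain ⟨m, hm⟩ := exists_nat_one_div_lt hε
  filter_upwards [hupper m, hlower m, eventually_gt_atTop 0] with n hn hn' hpos
  have hpos' : (0 : ℝ) < n := Nat.cast_pos.2 hpos
  rw [Real.dist_eq, sub_zero, abs_div, Nat.abs_cast, div_lt_iff₀' hpos']
  exact (abs_lt.2 ⟨neg_lt.1 hn', hn⟩).trans (by gcongr)

end SubGaussian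

section Cylinder

variable {Q : Type*}

lemma cylinder_succ (a : ℕ → Q) (n : ℕ) :
    PiNat.cylinder a (n + 1) = PiNat.cylinder a n ∩ {y | y n = a n} := by
  ext y
  simp only [PiNat.mem_cylinder_iff, Nat.forall_lt_succ_right, Set.mem_inter_iff,
    Set.mem_ofPred_eq]

variable [MeasurableSpace Q] [MeasurableSingletonClass Q]

lemma measurableSet_cylinder (a : ℕ → Q) (n : ℕ) : MeasurableSet (PiNat.cylinder a n) := by
  rw [PiNat.cylinder_eq_pi]
  exact .pi (Finset.countable_toSet _) fun i _ => measurableSet_singleton (a i)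

lemma measure_ext_of_cylinder [Countable Q] {μ ν : Measure (ℕ → Q)} [IsFiniteMeasure μ]
    (h : ∀ a n, μ (PiNat.cylinder a (n + 1)) = ν (PiNat.cylinder a (n + 1))) : μ = ν := by
  have hfamily : IsProjectiveMeasureFamily fun I : Finset ℕ => μ.map I.restrict := fun I J hJI =>
    (Measure.map_map (Finset.measurable_restrict₂ hJI) (Finset.measurable_restrict I)).symm
  refine IsProjectiveLimit.unique (fun _ => rfl)
    ((isProjectiveLimit_nat_iff hfamily ν).2 fun n => Measure.ext_of_singleton fun x => ?_)
  let a : ℕ → Q := fun i => x ⟨min i n, Finset.mem_Iic.2 (min_le_right i n)⟩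
  have hpreimage : Preorder.frestrictLe (π := fun _ : ℕ => Q) n ⁻¹' {x} =
      PiNat.cylinder a (n + 1) := by
    ext y
    simp only [Set.mem_preimage, Set.mem_singleton_iff, funext_iff, Subtype.forall,
      Finset.mem_Iic, Preorder.frestrictLe_apply, PiNat.mem_cylinder_iff, Nat.lt_succ_iff]
    exact forall₂_congr fun i hi => by simp [a, min_eq_left hi]
  have hmeas := Preorder.measurable_frestrictLe (X := fun _ : ℕ => Q) n
  rw [Measure.map_apply hmeas (measurableSet_singleton x), hpreimage, ← h, ← hpreimage]
  exact (Measure.map_apply hmeas (measurableSet_singleton x)).symm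

end Cylinder

lemma enat_toENNReal_eq_tsum (T : ℕ∞) :
    (T : ℝ≥0∞) = ∑' n : ℕ, if (n : ℕ∞) < T then 1 else 0 := by
  induction T using ENat.recTopCoe with
  | top => simp
  | coe k =>
    rw [tsum_eq_sum (s := Finset.range k) (by simp)]
    simp [Finset.filter_true_of_mem]

lemma tsum_le_of_add_le_mul {f : ℕ → ℝ≥0∞} {N : ℕ} {c : ℝ≥0∞} (hc : c < 1) (hf : ∀ n, f n ≤ 1)
    (hfN : ∀ n, f (n + N) ≤ c * f n) : ∑' n, f n ≤ N / (1 - c) := by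
  refine ENNReal.tsum_le_of_sum_range_le fun k => ?_
  set S := ∑ i ∈ Finset.range k, f i
  have hS : S ≠ ∞ :=
    ENNReal.sum_ne_top.2 fun i _ => ne_top_of_le_ne_top ENNReal.one_ne_top (hf i)
  have hrec : S ≤ N + c * S := calc
    S ≤ ∑ i ∈ Finset.range (N + k), f i :=
      Finset.sum_le_sum_of_subset (Finset.range_mono (Nat.le_add_left k N))
    _ = ∑ i ∈ Finset.range N, f i + ∑ i ∈ Finset.range k, f (N + i) := Finset.sum_range_add _ _ _
    _ ≤ ∑ i ∈ Finset.range N, 1 + ∑ i ∈ Finset.range k, c * f i := by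
      gcongr with i _ i _
      · exact hf i
      · exact add_comm N i ▸ hfN i
    _ = N + c * S := by simp [S, Finset.mul_sum]
  rw [ENNReal.le_div_iff_mul_le (.inl (tsub_pos_of_lt hc).ne') (.inl (by simp)), mul_comm,
    ENNReal.sub_mul fun _ _ => hS, one_mul]
  exact tsub_le_iff_right.2 hrec

namespace MarkovChain

lemma IsMarkov.measurable_path {Q Ω : Type*} [MeasurableSpace Q] [MeasurableSpace Ω]
    {M : MarkovChain Q} {X : ℕ → Ω → Q} {μ : Measure Ω} (hX : M.IsMarkov X μ) (m : ℕ) :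
    Measurable fun ω i => X (m + i + 1) ω :=
  measurable_pi_lambda _ fun i => hX.measurable (m + i + 1) (Nat.le_add_left 1 (m + i))

lemma measure_cylinder_eq_mul_prod {Q : Type*} [MeasurableSpace Q] {P : Measure (ℕ → Q)}
    {M : MarkovChain Q} (hP : ∀ a n, P (PiNat.cylinder a (n + 2)) =
      P (PiNat.cylinder a (n + 1)) * M.trans (a n) (a (n + 1))) (a : ℕ → Q) (n : ℕ) :
    P (PiNat.cylinder a (n + 1)) =
      P (PiNat.cylinder a 1) * ∏ i ∈ Finset.range n, M.trans (a i) (a (i + 1)) := by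
  induction n with
  | zero => simp
  | succ n ih => rw [hP, ih, Finset.prod_range_succ, mul_assoc]

section PathLaw

variable {Q : Type*} [Countable Q] [MeasurableSpace Q] [DiscreteMeasurableSpace Q]
  (M : MarkovChain Q)

instance (q : Q) : IsProbabilityMeasure (M.pathMeasure q) :=
  inferInstanceAs (IsProbabilityMeasure
    (Kernel.trajMeasure (X := fun _ : ℕ => Q) (PMF.pure q).toMeasure M.historyKernel))

/-- The law of the chain as a kernel from the state at time `0` to paths, so that
`M.pathKernel ∘ₘ ν` is the law of the chain with initial distribution `ν`. -/
noncomputable def pathKernel : Kernel Q (ℕ → Q) :=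
  Kernel.ofFunOfCountable M.pathMeasure

lemma pathKernel_apply (q : Q) : M.pathKernel q = M.pathMeasure q := rfl

instance : IsMarkovKernel M.pathKernel :=
  ⟨fun q => inferInstanceAs (IsProbabilityMeasure (M.pathMeasure q))⟩

lemma kernel_singleton (x y : Q) : M.kernel x {y} = M.trans x y :=
  PMF.toMeasure_apply_singleton _ _ (measurableSet_singleton y)

lemma ae_pathMeasure_zero_eq (q : Q) : ∀ᵐ y ∂M.pathMeasure q, y 0 = q := by
  have hlaw : (M.pathMeasure q).map (Preorder.frestrictLe (π := fun _ : ℕ => Q) 0) =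
      (Measure.dirac q).map (MeasurableEquiv.piUnique fun _ : Finset.Iic 0 => Q).symm := by
    rw [pathMeasure, Kernel.trajMeasure, Measure.map_comp _ _ (by fun_prop),
      Kernel.traj_map_frestrictLe, Kernel.partialTraj_self, Measure.id_comp, PMF.toMeasure_pure]
  have hstart : ∀ᵐ h ∂(M.pathMeasure q).map (Preorder.frestrictLe (π := fun _ : ℕ => Q) 0),
      h ⟨0, Finset.mem_Iic.2 le_rfl⟩ = q := by
    rw [hlaw, ae_map_iff (by fun_prop) MeasurableSet.of_discrete,
      ae_dirac_iff MeasurableSet.of_discrete]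
    rfl
  exact ae_of_ae_map (by fun_prop) hstart

lemma pathMeasure_cylinder_one (q : Q) (a : ℕ → Q) :
    M.pathMeasure q (PiNat.cylinder a 1) = Set.indicator {a 0} 1 q := by
  have hcylinder : PiNat.cylinder a 1 =ᵐ[M.pathMeasure q] {_y : ℕ → Q | q = a 0} := by
    refine eventuallyEq_set.2 ?_
    filter_upwards [M.ae_pathMeasure_zero_eq q] with y hy
    simp [PiNat.mem_cylinder_iff, hy]
  rw [measure_congr hcylinder]
  by_cases h : q = a 0 <;> simp [h]

lemma pathMeasure_cylinder_succ (q : Q) (a : ℕ → Q) (n : ℕ) :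
    M.pathMeasure q (PiNat.cylinder a (n + 2)) =
      M.pathMeasure q (PiNat.cylinder a (n + 1)) * M.trans (a n) (a (n + 1)) := by
  let r := Preorder.frestrictLe (π := fun _ : ℕ => Q) n
  have hr : Measurable r := Preorder.measurable_frestrictLe n
  have hpast : r ⁻¹' {r a} = PiNat.cylinder a (n + 1) := by
    ext y
    simp [r, funext_iff, PiNat.mem_cylinder_iff]
  have hpair : (fun y => (r y, y (n + 1))) ⁻¹' ({r a} ×ˢ {a (n + 1)}) =
      PiNat.cylinder a (n + 2) := by
    rw [Set.mk_preimage_prod, hpast, cylinder_succ a (n + 1)]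
    rfl
  calc M.pathMeasure q (PiNat.cylinder a (n + 2))
      = (M.pathMeasure q).map (fun y => (r y, y (n + 1))) ({r a} ×ˢ {a (n + 1)}) := by
        rw [Measure.map_apply (by fun_prop) (by measurability), hpair]
    _ = ((M.pathMeasure q).map r ⊗ₘ M.historyKernel n) ({r a} ×ˢ {a (n + 1)}) := by
        rw [pathMeasure, Kernel.map_frestrictLe_trajMeasure_compProd_eq_map_trajMeasure]
    _ = M.pathMeasure q (PiNat.cylinder a (n + 1)) * M.trans (a n) (a (n + 1)) := by
        rw [Measure.compProd_apply_prod (by measurability) (by measurability),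
          lintegral_singleton, Measure.map_apply hr (by measurability), hpast, mul_comm]
        exact congrArg _ (M.kernel_singleton (a n) (a (n + 1)))

lemma pathMeasure_cylinder (q : Q) (a : ℕ → Q) (n : ℕ) :
    M.pathMeasure q (PiNat.cylinder a (n + 1)) =
      Set.indicator {a 0} (fun _ => ∏ i ∈ Finset.range n, M.trans (a i) (a (i + 1))) q := by
  rw [measure_cylinder_eq_mul_prod (M.pathMeasure_cylinder_succ q), pathMeasure_cylinder_one]
  by_cases h : q = a 0 <;> simp [h]

lemma pathKernel_comp_cylinder (ν : Measure Q) (a : ℕ → Q) (n : ℕ) :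
    (M.pathKernel ∘ₘ ν) (PiNat.cylinder a (n + 1)) =
      ν {a 0} * ∏ i ∈ Finset.range n, M.trans (a i) (a (i + 1)) := by
  rw [Measure.bind_apply (measurableSet_cylinder a _) (Kernel.aemeasurable _)]
  simp only [pathKernel_apply, pathMeasure_cylinder]
  rw [lintegral_indicator_const (measurableSet_singleton _), mul_comm]

lemma map_shift_pathMeasure (q : Q) :
    (M.pathMeasure q).map (fun y i => y (i + 1)) = M.pathKernel ∘ₘ M.kernel q := by
  refine measure_ext_of_cylinder fun a n => ?_
  let a' : ℕ → Q := fun i => i.casesOn q a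
  have hpreimage : (fun (y : ℕ → Q) i => y (i + 1)) ⁻¹' PiNat.cylinder a (n + 1)
      =ᵐ[M.pathMeasure q] PiNat.cylinder a' (n + 2) := by
    refine eventuallyEq_set.2 ?_
    filter_upwards [M.ae_pathMeasure_zero_eq q] with y hy
    simp [PiNat.mem_cylinder_iff, a', hy, Nat.forall_lt_succ_left (n := n + 1)]
  rw [Measure.map_apply (by fun_prop) (measurableSet_cylinder a _), measure_congr hpreimage,
    pathMeasure_cylinder, Finset.prod_range_succ', pathKernel_comp_cylinder, kernel_singleton]
  simp [a', mul_comm]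

lemma map_shift_pathKernel_comp (ν : Measure Q) :
    (M.pathKernel ∘ₘ ν).map (fun y i => y (i + 1)) = M.pathKernel ∘ₘ M.kernel ∘ₘ ν := by
  have hkernel : M.pathKernel.map (fun y i => y (i + 1)) = M.pathKernel ∘ₖ M.kernel := by
    ext1 q
    rw [Kernel.map_apply _ (by fun_prop), Kernel.comp_apply, pathKernel_apply,
      map_shift_pathMeasure]
  rw [Measure.map_comp _ _ (by fun_prop), hkernel, Measure.comp_assoc]

variable {M} {Ω : Type*} [MeasurableSpace Ω] {μ : Measure Ω} {X : ℕ → Ω → Q}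

lemma IsMarkov.map_path [IsFiniteMeasure μ] (hX : M.IsMarkov X μ) :
    μ.map (fun ω i => X (i + 1) ω) = M.pathKernel ∘ₘ M.initial.toMeasure := by
  have hpath : Measurable fun ω i => X (i + 1) ω := by simpa using hX.measurable_path 0
  have hpreimage (a : ℕ → Q) (n : ℕ) : (fun ω i => X (i + 1) ω) ⁻¹' PiNat.cylinder a n =
      {ω | ∀ i, 1 ≤ i → i ≤ n → X i ω = a (i - 1)} := by
    ext ω
    refine ⟨fun h i hi hin => ?_, fun h i hi => h (i + 1) (Nat.le_add_left 1 i) hi⟩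
    obtain ⟨i, rfl⟩ := Nat.exists_eq_add_of_le' hi
    exact h i hin
  have hinitial (a : ℕ → Q) : μ.map (fun ω i => X (i + 1) ω) (PiNat.cylinder a 1) =
      M.initial.toMeasure {a 0} := by
    rw [Measure.map_apply hpath (measurableSet_cylinder a 1),
      PMF.toMeasure_apply_singleton _ _ (measurableSet_singleton _), ← hX.initial]
    simp [PiNat.cylinder]
  have hstep (a : ℕ → Q) (n : ℕ) : μ.map (fun ω i => X (i + 1) ω) (PiNat.cylinder a (n + 2)) =
      μ.map (fun ω i => X (i + 1) ω) (PiNat.cylinder a (n + 1)) *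
        M.trans (a n) (a (n + 1)) := by
    have hsplit : (fun ω i => X (i + 1) ω) ⁻¹' PiNat.cylinder a (n + 2) =
        (fun ω i => X (i + 1) ω) ⁻¹' PiNat.cylinder a (n + 1) ∩ {ω | X (n + 2) ω = a (n + 1)} := by
      rw [cylinder_succ a (n + 1)]
      rfl
    rw [Measure.map_apply hpath (measurableSet_cylinder a _),
      Measure.map_apply hpath (measurableSet_cylinder a _), hsplit]
    by_cases h : μ ((fun ω i => X (i + 1) ω) ⁻¹' PiNat.cylinder a (n + 1)) = 0
    · rw [measure_inter_null_of_null_left _ h, h, zero_mul]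
    · rw [← cond_mul_eq_inter (hpath (measurableSet_cylinder a _)), mul_comm]
      rw [hpreimage] at h ⊢
      rw [hX.step (n + 1) (Nat.le_add_left 1 n) _ _ h, Nat.add_sub_cancel]
  refine measure_ext_of_cylinder fun a n => ?_
  rw [measure_cylinder_eq_mul_prod hstep, hinitial, pathKernel_comp_cylinder]

lemma IsMarkov.exists_map_path_eq [IsFiniteMeasure μ] (hX : M.IsMarkov X μ) (m : ℕ) :
    ∃ ν : Measure Q, IsProbabilityMeasure ν ∧
      μ.map (fun ω i => X (m + i + 1) ω) = M.pathKernel ∘ₘ ν := by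
  induction m with
  | zero => exact ⟨M.initial.toMeasure, inferInstance, by simpa using hX.map_path⟩
  | succ m ih =>
    obtain ⟨ν, hν, hlaw⟩ := ih
    refine ⟨M.kernel ∘ₘ ν, inferInstance, ?_⟩
    rw [← map_shift_pathKernel_comp, ← hlaw, Measure.map_map (by fun_prop) (hX.measurable_path m)]
    simp only [Function.comp_def, ← add_assoc, add_right_comm m 1]

end PathLaw

section HittingTime

lemma lt_returnTime_iff {Q : Type*} {q : Q} {y : ℕ → Q} {n : ℕ} :
    (n : ℕ∞) < returnTime q y ↔ ∀ i, 1 ≤ i → i ≤ n → y i ≠ q := by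
  rw [← ENat.add_one_le_iff (ENat.natCast_ne_top n), returnTime, le_iInf₂_iff]
  refine forall_congr' fun i => ⟨fun h hi hin hq => ?_, fun h hi => ?_⟩
  · exact hin.not_gt (by exact_mod_cast h ⟨hi, hq⟩)
  · exact_mod_cast not_le.1 fun hin => h hi.1 hin hi.2

lemma measurableSet_lt_returnTime {Q : Type*} [MeasurableSpace Q] [MeasurableSingletonClass Q]
    (q : Q) (n : ℕ) : MeasurableSet {y : ℕ → Q | (n : ℕ∞) < returnTime q y} := by
  simp only [lt_returnTime_iff, Set.ofPred_forall]
  exact .iInter fun i => .iInter fun _ => .iInter fun _ =>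
    (measurableSet_singleton q).compl.preimage (measurable_pi_apply i)

variable {Q : Type*} [Countable Q] [MeasurableSpace Q] [DiscreteMeasurableSpace Q]
  (M : MarkovChain Q)

/-- The probability that the chain started in `x` does not visit `q` at the times `1, …, n`. -/
noncomputable def avoidProb (q : Q) (n : ℕ) (x : Q) : ℝ≥0∞ :=
  M.pathMeasure x {y | (n : ℕ∞) < returnTime q y}

/-- The expected time of the first visit to `q` at a time `n ≥ 1` of the chain started in `x`. -/
noncomputable def expectedHittingTime (q x : Q) : ℝ≥0∞ :=
  ∫⁻ y, (returnTime q y : ℝ≥0∞) ∂M.pathMeasure x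

lemma expectedHittingTime_self (q : Q) :
    M.expectedHittingTime q q = M.expectedReturnTime q := rfl

lemma expectedHittingTime_eq_tsum (q x : Q) :
    M.expectedHittingTime q x = ∑' n, M.avoidProb q n x := by
  have hind (n : ℕ) : (fun y => if (n : ℕ∞) < returnTime q y then 1 else 0) =
      Set.indicator {y | (n : ℕ∞) < returnTime q y} (1 : (ℕ → Q) → ℝ≥0∞) := by
    ext y
    simp [Set.indicator_apply]
  have hmeas (n : ℕ) := measurableSet_lt_returnTime q n
  simp only [expectedHittingTime, enat_toENNReal_eq_tsum (returnTime q _)]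
  rw [lintegral_tsum fun n => hind n ▸ (measurable_one.indicator (hmeas n)).aemeasurable]
  simp only [hind, lintegral_indicator_one (hmeas _), avoidProb]

lemma avoidProb_le_one (q : Q) (n : ℕ) (x : Q) : M.avoidProb q n x ≤ 1 := prob_le_one

lemma avoidProb_antitone (q x : Q) : Antitone fun n => M.avoidProb q n x := fun _ _ hmn =>
  measure_mono (Set.ofPred_subset_ofPred.2 fun _ hy => lt_of_le_of_lt (Nat.cast_le.2 hmn) hy)

lemma avoidProb_zero (q x : Q) : M.avoidProb q 0 x = 1 := by
  have huniv : {y : ℕ → Q | ((0 : ℕ) : ℕ∞) < returnTime q y} = Set.univ :=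
    Set.eq_univ_of_forall fun y => lt_returnTime_iff.2 fun i hi hi0 => by omega
  rw [avoidProb, huniv, measure_univ]

lemma avoidProb_succ (q : Q) (n : ℕ) (x : Q) :
    M.avoidProb q (n + 1) x = ∫⁻ y, ({q}ᶜ : Set Q).indicator (M.avoidProb q n) y ∂M.kernel x := by
  let A : Set (ℕ → Q) := {y | y 0 ∈ ({q}ᶜ : Set Q)} ∩ {y | (n : ℕ∞) < returnTime q y}
  have hA : MeasurableSet A :=
    ((measurableSet_singleton q).compl.preimage (measurable_pi_apply 0)).inter
      (measurableSet_lt_returnTime q n)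
  have hpreimage : {y | ((n + 1 : ℕ) : ℕ∞) < returnTime q y} = (fun y i => y (i + 1)) ⁻¹' A := by
    ext y
    simp only [A, Set.mem_preimage, Set.mem_inter_iff, Set.mem_ofPred_eq, lt_returnTime_iff]
    refine ⟨fun h => ⟨h 1 le_rfl (by omega), fun i _ hi => h (i + 1) (by omega) (by omega)⟩,
      fun h i hi hin => ?_⟩
    obtain ⟨i, rfl⟩ := Nat.exists_eq_add_of_le' hi
    rcases Nat.eq_zero_or_pos i with rfl | hi
    · exact h.1
    · exact h.2 i hi (by omega)
  have hpath (y : Q) : M.pathKernel y A = ({q}ᶜ : Set Q).indicator (M.avoidProb q n) y := by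
    rw [pathKernel_apply]
    by_cases hy : y ∈ ({q}ᶜ : Set Q)
    · rw [Set.indicator_of_mem hy]
      refine measure_congr (eventuallyEq_set.2 ?_)
      filter_upwards [M.ae_pathMeasure_zero_eq y] with z hz
      simp [A, hz, show y ≠ q from hy]
    · rw [Set.indicator_of_notMem hy]
      refine measure_mono_null Set.inter_subset_left (ae_iff.1 ?_)
      filter_upwards [M.ae_pathMeasure_zero_eq y] with z hz
      simpa [hz] using hy
  rw [avoidProb, hpreimage, ← Measure.map_apply (by fun_prop) hA, map_shift_pathMeasure,
    Measure.bind_apply hA (Kernel.aemeasurable _)]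
  exact lintegral_congr hpath

lemma expectedHittingTime_eq_one_add_lintegral (q x : Q) : M.expectedHittingTime q x =
    1 + ∫⁻ y, ({q}ᶜ : Set Q).indicator (M.expectedHittingTime q) y ∂M.kernel x := by
  have hind (y : Q) : ({q}ᶜ : Set Q).indicator (M.expectedHittingTime q) y =
      ∑' n, ({q}ᶜ : Set Q).indicator (M.avoidProb q n) y := by
    by_cases hy : y = q <;> simp [hy, expectedHittingTime_eq_tsum]
  simp only [hind]
  rw [lintegral_tsum fun _ => Measurable.of_discrete.aemeasurable,
    expectedHittingTime_eq_tsum, tsum_eq_zero_add' ENNReal.summable, avoidProb_zero]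
  simp only [avoidProb_succ]

variable {M} {q : Q}

lemma avoidProb_add_le {N : ℕ} {c : ℝ≥0∞} (hc : ∀ x, M.avoidProb q N x ≤ c) (n : ℕ) (x : Q) :
    M.avoidProb q (n + N) x ≤ c * M.avoidProb q n x := by
  induction n generalizing x with
  | zero => simpa [avoidProb_zero] using hc x
  | succ n ih =>
    rw [Nat.add_right_comm, avoidProb_succ, avoidProb_succ,
      ← lintegral_const_mul _ Measurable.of_discrete]
    refine lintegral_mono fun y => ?_
    by_cases hy : y = q <;> simp [hy, ih]

lemma iSup_expectedHittingTime_ne_top_of_avoidProb_le {N : ℕ} {c : ℝ≥0∞} (hc : c < 1)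
    (hN : ∀ x, M.avoidProb q N x ≤ c) : ⨆ x, M.expectedHittingTime q x ≠ ∞ := by
  refine ne_top_of_le_ne_top (ENNReal.div_ne_top (ENNReal.natCast_ne_top N)
    (tsub_pos_of_lt hc).ne') (iSup_le fun x => ?_)
  rw [expectedHittingTime_eq_tsum]
  exact tsum_le_of_add_le_mul hc (fun n => M.avoidProb_le_one q n x)
    fun n => avoidProb_add_le hN n x

lemma avoidProb_succ_lt_one {x y : Q} {n : ℕ} (hxy : M.trans x y ≠ 0)
    (hy : y = q ∨ M.avoidProb q n y < 1) : M.avoidProb q (n + 1) x < 1 := by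
  have hle (z : Q) : ({q}ᶜ : Set Q).indicator (M.avoidProb q n) z ≤ 1 :=
    Set.indicator_apply_le' (fun _ => M.avoidProb_le_one q n z) fun _ => zero_le_one
  have hlt : ({q}ᶜ : Set Q).indicator (M.avoidProb q n) y < 1 := by
    rcases hy with rfl | hy
    · simp
    · exact (Set.indicator_le_self _ _ y).trans_lt hy
  calc M.avoidProb q (n + 1) x
      = ∫⁻ z, ({q}ᶜ : Set Q).indicator (M.avoidProb q n) z ∂M.kernel x := M.avoidProb_succ q n x
    _ < ∫⁻ _, 1 ∂M.kernel x :=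
      lintegral_strict_mono_of_ae_le_of_ae_lt_on (s := {y}) (by fun_prop)
        (((lintegral_mono hle).trans_lt (by simp)).ne) (ae_of_all _ hle)
        (by rwa [kernel_singleton]) (ae_of_all _ fun z hz => hz ▸ hlt)
    _ = 1 := by simp

lemma exists_avoidProb_lt_one
    (hq : ∀ x, Relation.ReflTransGen (fun a b => M.trans a b ≠ 0) x q) (x : Q) :
    ∃ n, M.avoidProb q n x < 1 := by
  have hreach (y : Q) : y = q ∨ ∃ n, M.avoidProb q n y < 1 := by
    induction hq y using Relation.ReflTransGen.head_induction_on with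
    | refl => exact .inl rfl
    | head hxy _ ih =>
      rcases ih with h | ⟨n, h⟩
      · exact .inr ⟨0 + 1, avoidProb_succ_lt_one hxy (.inl h)⟩
      · exact .inr ⟨n + 1, avoidProb_succ_lt_one hxy (.inr h)⟩
  obtain ⟨y, hxy⟩ := (M.trans x).support_nonempty
  rcases hreach y with h | ⟨n, h⟩
  · exact ⟨0 + 1, avoidProb_succ_lt_one hxy (.inl h)⟩
  · exact ⟨n + 1, avoidProb_succ_lt_one hxy (.inr h)⟩

end HittingTime

lemma iSup_expectedHittingTime_ne_top {Q : Type*} [Finite Q] [MeasurableSpace Q]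
    [DiscreteMeasurableSpace Q] {M : MarkovChain Q} {q : Q}
    (hq : ∀ x, Relation.ReflTransGen (fun a b => M.trans a b ≠ 0) x q) :
    ⨆ x, M.expectedHittingTime q x ≠ ∞ := by
  have := Fintype.ofFinite Q
  choose n hn using exists_avoidProb_lt_one hq
  let N := Finset.univ.sup n
  have hN (x : Q) : M.avoidProb q N x < 1 :=
    (M.avoidProb_antitone q x (Finset.le_sup (Finset.mem_univ x))).trans_lt (hn x)
  exact iSup_expectedHittingTime_ne_top_of_avoidProb_le
    ((Finset.sup_lt_iff one_pos).2 fun x _ => hN x) fun x => Finset.le_sup (Finset.mem_univ x)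

section Deviation

variable {Q : Type*} [Countable Q] [MeasurableSpace Q] [DiscreteMeasurableSpace Q]
  (M : MarkovChain Q)

/-- The sum of the deviations of `g` from its conditional expectation over the first `k`
transitions of the path `y`; under the law of the chain, this is a martingale in `k`. -/
noncomputable def deviation (g : Q → ℝ) (k : ℕ) (y : ℕ → Q) : ℝ :=
  ∑ i ∈ Finset.range k, (g (y (i + 1)) - ∫ z, g z ∂M.kernel (y i))

lemma deviation_succ (g : Q → ℝ) (k : ℕ) (y : ℕ → Q) :
    M.deviation g (k + 1) y =
      (g (y 1) - ∫ z, g z ∂M.kernel (y 0)) + M.deviation g k fun i => y (i + 1) := by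
  rw [deviation, Finset.sum_range_succ', add_comm]
  rfl

lemma measurable_deviation (g : Q → ℝ) (k : ℕ) : Measurable (M.deviation g k) :=
  Finset.measurable_fun_sum _ fun i _ =>
    ((Measurable.of_discrete (f := g)).comp (measurable_pi_apply (i + 1))).sub
      ((Measurable.of_discrete (f := fun x => ∫ z, g z ∂M.kernel x)).comp (measurable_pi_apply i))

lemma ae_compProd_pathKernel_snd_zero_eq (ν : Measure Q) :
    ∀ᵐ p ∂(ν ⊗ₘ M.pathKernel), p.2 0 = p.1 :=
  Measure.ae_compProd_of_ae_ae (measurableSet_eq_fun (by fun_prop) (by fun_prop))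
    (ae_of_all _ M.ae_pathMeasure_zero_eq)

variable {g : Q → ℝ} {a b : ℝ}

/-- Azuma–Hoeffding, by induction on `k`: the first increment has mean zero and range in an
interval of length `b - a`, and the remaining ones are those of the chain restarted at time `1`. -/
lemma hasSubgaussianMGF_deviation_pathMeasure (hg : ∀ x, g x ∈ Set.Icc a b) (k : ℕ) (x : Q) :
    HasSubgaussianMGF (M.deviation g k) (k * (‖b - a‖₊ / 2) ^ 2) (M.pathMeasure x) := by
  induction k generalizing x with
  | zero =>
    have hzero : M.deviation g 0 = fun _ => 0 := funext fun _ => Finset.sum_range_zero _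
    simp [hzero]
  | succ k ih =>
    let F : (ℕ → Q) → ℝ := fun y => (g (y 0) - ∫ z, g z ∂M.kernel x) + M.deviation g k y
    have hF : Measurable F := by
      have := M.measurable_deviation g k
      have : Measurable g := .of_discrete
      fun_prop
    have hincrement : HasSubgaussianMGF (fun z => g z - ∫ z, g z ∂M.kernel x)
        ((‖b - a‖₊ / 2) ^ 2) (M.kernel x) :=
      hasSubgaussianMGF_of_mem_Icc Measurable.of_discrete.aemeasurable (ae_of_all _ hg)
    have hsum : HasSubgaussianMGF (fun p : Q × (ℕ → Q) => F p.2)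
        ((‖b - a‖₊ / 2) ^ 2 + k * (‖b - a‖₊ / 2) ^ 2) (M.kernel x ⊗ₘ M.pathKernel) := by
      refine (hasSubgaussianMGF_add_compProd hincrement (M.measurable_deviation g k) ih).congr ?_
      filter_upwards [M.ae_compProd_pathKernel_snd_zero_eq (M.kernel x)] with p hp
      simp [F, hp]
    have hshift : HasSubgaussianMGF (F ∘ fun y i => y (i + 1))
        ((‖b - a‖₊ / 2) ^ 2 + k * (‖b - a‖₊ / 2) ^ 2) (M.pathMeasure x) := by
      rwa [← hasSubgaussianMGF_map_iff (by fun_prop) hF, map_shift_pathMeasure,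
        ← Measure.snd_compProd, Measure.snd, hasSubgaussianMGF_map_iff measurable_snd hF]
    rw [Nat.cast_succ, add_one_mul, add_comm (_ * _)]
    refine hshift.congr ?_
    filter_upwards [M.ae_pathMeasure_zero_eq x] with y hy
    simp [F, deviation_succ, hy]

end Deviation

section Potential

variable {Q : Type*} [Countable Q] [MeasurableSpace Q] [DiscreteMeasurableSpace Q]
  (M : MarkovChain Q)

/-- The expected time of the first visit to `q` at a time `n ≥ 0` of the chain started in `x`,
hence `0` at `q`. It solves the Poisson equation of the indicator function of `q`. -/
noncomputable def potential (q : Q) : Q → ℝ :=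
  ({q}ᶜ : Set Q).indicator fun x => (M.expectedHittingTime q x).toReal

variable {M} {q : Q}

lemma integral_potential (hfin : ∀ x, M.expectedHittingTime q x ≠ ∞) (x : Q) :
    ∫ y, M.potential q y ∂M.kernel x = (M.expectedHittingTime q x).toReal - 1 := by
  have htoReal (y : Q) : M.potential q y =
      (({q}ᶜ : Set Q).indicator (M.expectedHittingTime q) y).toReal := by
    by_cases hy : y = q <;> simp [potential, hy]
  have hlt (y : Q) : ({q}ᶜ : Set Q).indicator (M.expectedHittingTime q) y < ∞ :=
    (Set.indicator_le_self _ _ y).trans_lt (hfin y).lt_top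
  have hstep := M.expectedHittingTime_eq_one_add_lintegral q x
  simp only [htoReal]
  rw [integral_toReal Measurable.of_discrete.aemeasurable (ae_of_all _ hlt), hstep,
    ENNReal.toReal_add ENNReal.one_ne_top (ENNReal.add_ne_top.1 (hstep ▸ hfin x)).2,
    ENNReal.toReal_one, add_sub_cancel_left]

lemma sum_indicator_mul_expectedHittingTime (hfin : ∀ x, M.expectedHittingTime q x ≠ ∞)
    (y : ℕ → Q) (k : ℕ) :
    (∑ i ∈ Finset.range k, Set.indicator {q} (1 : Q → ℝ) (y i)) *
        (M.expectedHittingTime q q).toReal =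
      k - M.deviation (M.potential q) k y + (M.potential q (y k) - M.potential q (y 0)) := by
  have hvisit (x : Q) : Set.indicator {q} (1 : Q → ℝ) x * (M.expectedHittingTime q q).toReal =
      (M.expectedHittingTime q x).toReal - M.potential q x := by
    by_cases hx : x = q <;> simp [potential, hx]
  rw [← Finset.sum_range_sub (fun i => M.potential q (y i)), deviation, Finset.sum_mul]
  simp only [hvisit, integral_potential hfin, Finset.sum_sub_distrib, Finset.sum_const,
    Finset.card_range, nsmul_eq_mul, mul_one]
  ring

lemma potential_mem_Icc (hq : ⨆ x, M.expectedHittingTime q x ≠ ∞) (x : Q) :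
    M.potential q x ∈ Set.Icc 0 (⨆ x, M.expectedHittingTime q x).toReal := by
  by_cases hx : x = q
  · simp [potential, hx]
  · simpa [potential, hx] using ENNReal.toReal_mono hq (le_iSup (M.expectedHittingTime q) x)

lemma tendsto_sum_indicator_div (hq : ⨆ x, M.expectedHittingTime q x ≠ ∞) {y : ℕ → ℕ → Q}
    (hy : Tendsto (fun n : ℕ => M.deviation (M.potential q) n (y n) / n) atTop (𝓝 0)) :
    Tendsto (fun n : ℕ => (∑ i ∈ Finset.range n, Set.indicator {q} (1 : Q → ℝ) (y n i)) / n)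
      atTop (𝓝 (M.frequency q)) := by
  have hfin (x : Q) : M.expectedHittingTime q x ≠ ∞ := ne_top_of_le_ne_top hq (le_iSup _ x)
  have hpos : (M.expectedHittingTime q q).toReal ≠ 0 := by
    refine ENNReal.toReal_ne_zero.2 ⟨?_, hfin q⟩
    simp [M.expectedHittingTime_eq_one_add_lintegral q q]
  have hboundary : Tendsto (fun n : ℕ =>
      (M.potential q (y n n) - M.potential q (y n 0)) / n) atTop (𝓝 0) := by
    refine squeeze_zero_norm (fun n => ?_)
      (tendsto_const_div_atTop_nhds_zero_nat (⨆ x, M.expectedHittingTime q x).toReal)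
    rw [norm_div, Real.norm_natCast]
    gcongr
    simpa [Real.dist_eq] using Real.dist_le_of_mem_Icc (potential_mem_Icc hq (y n n))
      (potential_mem_Icc hq (y n 0))
  have hlim := ((tendsto_const_nhds (x := (1 : ℝ)).sub hy).add hboundary).div_const
    (M.expectedHittingTime q q).toReal
  rw [sub_zero, add_zero, one_div] at hlim
  rw [frequency, ← expectedHittingTime_self, ENNReal.toReal_inv]
  refine hlim.congr' ?_
  filter_upwards [eventually_ne_atTop 0] with n hn
  rw [div_eq_iff hpos, div_mul_eq_mul_div, sum_indicator_mul_expectedHittingTime hfin]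
  field_simp

end Potential

lemma IsMarkov.hasSubgaussianMGF_deviation {Q : Type*} [Countable Q] [MeasurableSpace Q]
    [DiscreteMeasurableSpace Q] {M : MarkovChain Q} {Ω : Type*} [MeasurableSpace Ω]
    {μ : Measure Ω} [IsFiniteMeasure μ] {X : ℕ → Ω → Q} (hX : M.IsMarkov X μ)
    {g : Q → ℝ} {a b : ℝ} (hg : ∀ x, g x ∈ Set.Icc a b) (m k : ℕ) :
    HasSubgaussianMGF (fun ω => M.deviation g k fun i => X (m + i + 1) ω)
      (k * (‖b - a‖₊ / 2) ^ 2) μ := by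
  obtain ⟨ν, hν, hlaw⟩ := hX.exists_map_path_eq m
  refine (hasSubgaussianMGF_map_iff (hX.measurable_path m) (M.measurable_deviation g k)).1 ?_
  rw [hlaw]
  exact hasSubgaussianMGF_comp (M.measurable_deviation g k)
    (M.hasSubgaussianMGF_deviation_pathMeasure hg k)

end MarkovChain

lemma visits_eq_sum_indicator {Q Ω : Type*} (s : ℕ → ℕ) (X : ℕ → Ω → Q) (q : Q) (n k : ℕ)
    (ω : Ω) : (visits s X q n k ω : ℝ) =
      ∑ i ∈ Finset.range k, Set.indicator {q} (1 : Q → ℝ) (X (s n + i + 1) ω) := by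
  classical
  rw [visits, ← Finset.Ico_add_one_right_eq_Icc, Finset.sum_Ico_eq_sum_range]
  push_cast
  simp [Set.indicator_apply, add_assoc, add_comm 1]

theorem mainTheorem1_general {Q : Type*} [Countable Q] [MeasurableSpace Q]
    [DiscreteMeasurableSpace Q] (M : MarkovChain Q) (q : Q)
    (hq : ⨆ x, M.expectedHittingTime q x ≠ ∞) (s : ℕ → ℕ)
    {Ω : Type*} [MeasurableSpace Ω] (μ : Measure Ω) [IsProbabilityMeasure μ]
    (X : ℕ → Ω → Q) (hX : M.IsMarkov X μ) :
    ∀ᵐ ω ∂μ, Tendsto (fun n : ℕ => (visits s X q n n ω : ℝ) / n) atTop (𝓝 (M.frequency q)) := by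
  have hdeviation : ∀ᵐ ω ∂μ, Tendsto (fun n : ℕ =>
      M.deviation (M.potential q) n (fun i => X (s n + i + 1) ω) / n) atTop (𝓝 0) :=
    ae_tendsto_div_zero_of_hasSubgaussianMGF fun n =>
      hX.hasSubgaussianMGF_deviation (MarkovChain.potential_mem_Icc hq) (s n) n
  filter_upwards [hdeviation] with ω hω
  simp only [visits_eq_sum_indicator]
  exact MarkovChain.tendsto_sum_indicator_div hq hω

theorem mainTheorem1 {Q : Type*} [Finite Q] [MeasurableSpace Q] [DiscreteMeasurableSpace Q]
    (M : MarkovChain Q) (hM : M.Connected) (s : ℕ → ℕ)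
    {Ω : Type*} [MeasurableSpace Ω] (μ : Measure Ω) [IsProbabilityMeasure μ]
    (X : ℕ → Ω → Q) (hX : M.IsMarkov X μ) (q : Q) :
    ∀ᵐ ω ∂μ, Tendsto (fun n : ℕ => (visits s X q n n ω : ℝ) / n) atTop (𝓝 (M.frequency q)) := by
  exact mainTheorem1_general M q
    (MarkovChain.iSup_expectedHittingTime_ne_top fun x => hM x q) s μ X hX
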